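/- Let $\lambda>0$. A function $\varphi:(0,\infty)\to\mathbb R$ is completely monotonic if it is $C^\infty$ and $(-1)^n\varphi^{(n)}(x)\ge 0$ for all $n\ge 0$ and $x>0$. Let $\mathcal B_\lambda$ be the class of generalized Bernstein functions of order $\lambda$, that is, of all $C^\infty$ functions $f:(0,\infty)\to[0,\infty)$ such that $x\mapsto x^{1-\lambda}f'(x)$ is completely monotonic. For $f\in\mathcal B_\lambda$ the function $t^{-\lambda}f(t)$ is known to be completely monotonic, so by Bernstein's theorem it is the Laplace transform of a unique positive measure on $[0,\infty)$. Let $f\in\mathcal B_\lambda$ be bounded and non-constant, and let $\omega$ be the positive measure on $[0,\infty)$ in the Bernstein representation of $t^{-\lambda}f(t)$, that is, $$t^{-\lambda}f(t)=\mathcal L(\omega)(t):=\int_{[0,\infty)}e^{-ts}\,d\omega(s)\qquad (t>0),$$ with convergent integrals. Then, for all $x,y>0$, the integral $\int_{[0,\infty)}(y+xs)^{-(\lambda+y)}\,d\omega(s)$ converges, and the following holds. (i) If $\lambda\le 1$, then $$y^{y}\,\frac{\Gamma(\lambda+y)}{\Gamma(y)}\int_{[0,\infty)}\frac{d\omega(s)}{(y+xs)^{\lambda+y}}<\mathcal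 L(\omega)(x).$$ (ii) If $\lambda>1$, then $$y^{\lambda+y}\int_{[0,\infty)}\frac{d\omega(s)}{(y+xs)^{\lambda+y}}<\mathcal L(\omega)(x).$$ -/

import Mathlib

open Set MeasureTheory
open scoped NNReal ContDiff

/-- A function on the open half-line `(0, ∞)` (the values at other reals are irrelevant) is
completely monotonic if it is smooth there and `(-1)^n φ^(n) ≥ 0` there for every `n`. -/
def CompletelyMonotonic (φ : ℝ → ℝ) : Prop :=
  ContDiffOn ℝ ∞ φ (Ioi 0) ∧ ∀ n : ℕ, ∀ x : ℝ, 0 < x → 0 ≤ (-1) ^ n * iteratedDeriv n φ x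

/-- The class of generalized Bernstein functions of order `lam`: non-negative smooth functions
`f` on `(0, ∞)` such that `f'(x) x^(1 - lam)` is completely monotonic. -/
def IsGenBernstein (lam : ℝ) (f : ℝ → ℝ) : Prop :=
  ContDiffOn ℝ ∞ f (Ioi 0) ∧ (∀ x : ℝ, 0 < x → 0 ≤ f x) ∧
    CompletelyMonotonic (fun x => deriv f x * x ^ (1 - lam))

/-- The Laplace transform of a positive measure on the closed half-line `[0, ∞)`. -/
noncomputable def laplaceTransform (μ : Measure ℝ≥0) (x : ℝ) : ℝ :=
  ∫ s, Real.exp (-(x * (s : ℝ))) ∂μ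

/-- `μ` is the measure in the Bernstein representation of the function `F` on `(0, ∞)`: the
Laplace transform of `μ` converges at every `t > 0`, with value `F t`. -/
def IsBernsteinMeasure (μ : Measure ℝ≥0) (F : ℝ → ℝ) : Prop :=
  ∀ t : ℝ, 0 < t →
    Integrable (fun s : ℝ≥0 => Real.exp (-(t * (s : ℝ)))) μ ∧ laplaceTransform μ t = F t

/-! By Fubini, `Γ(lam + y)` times the Stieltjes integral is `x ^ (-lam)` times the integral of `f (x
* t)` against `t ^ (y - 1) * exp (-(y * t))`. Up to the mass `Γ(y) / y ^ y`, this kernel is the law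
of a gamma variable `T` of mean 1, so the claim is a strict Jensen inequality
(`integral_gamma_kernel_mul_lt`). If `lam ≤ 1`, `f` is concave and `E f(xT) < f x`. If `lam > 1`,
`f` is only concave in `u ^ lam`; since `E T ^ lam ≥ 1` and the tangent at `x` is nonnegative at 0,
`E f(xT) < f x * E T ^ lam`. A bounded non-constant `f` cannot coincide with its tangent, whence
strictness. -/

theorem CompletelyMonotonic.nonneg {φ : ℝ → ℝ} (h : CompletelyMonotonic φ) {x : ℝ} (hx : 0 < x) :
    0 ≤ φ x := by
  simpa using h.2 0 x hx

theorem CompletelyMonotonic.antitoneOn {φ : ℝ → ℝ} (h : CompletelyMonotonic φ) :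
    AntitoneOn φ (Ioi 0) := by
  refine antitoneOn_of_deriv_nonpos (convex_Ioi 0) h.1.continuousOn ?_ ?_
  · rw [interior_Ioi]
    exact h.1.differentiableOn (by simp)
  · intro x hx
    rw [interior_Ioi] at hx
    have := h.2 1 x hx
    simpa using this

/-- Tangent inequality: if `f' u * u ^ (1 - p)` is antitone, then `f` is a concave function
of `u ^ p`. -/
theorem le_tangent_rpow {f : ℝ → ℝ} {p : ℝ} (hp : 0 < p)
    (hd : ∀ u : ℝ, 0 < u → DifferentiableAt ℝ f u)
    (ha : AntitoneOn (fun u => deriv f u * u ^ (1 - p)) (Ioi 0)) {x : ℝ} (hx : 0 < x)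
    {u : ℝ} (hu : 0 < u) :
    f u ≤ f x + deriv f x * x ^ (1 - p) / p * (u ^ p - x ^ p) := by
  set c := deriv f x * x ^ (1 - p) / p with hc
  have hcp : c * p = deriv f x * x ^ (1 - p) := by rw [hc]; field_simp
  set g : ℝ → ℝ := fun v => f v - c * v ^ p with hg
  have hgd : ∀ v : ℝ, 0 < v → HasDerivAt g (v ^ (p - 1) *
      (deriv f v * v ^ (1 - p) - deriv f x * x ^ (1 - p))) v := by
    intro v hv
    have h1 : HasDerivAt g (deriv f v - c * (p * v ^ (p - 1))) v := (hd v hv).hasDerivAt.sub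
      ((Real.hasDerivAt_rpow_const (p := p) (Or.inl hv.ne')).const_mul c)
    refine h1.congr_deriv ?_
    have h2 : v ^ (p - 1) * v ^ (1 - p) = 1 := by
      rw [← Real.rpow_add hv]; simp
    rw [← hcp]
    linear_combination -deriv f v * h2
  have hgc : ContinuousOn g (Ioi 0) := fun v hv => (hgd v hv).continuousAt.continuousWithinAt
  have key : g u ≤ g x := by
    rcases le_total u x with hux | hxu
    · have hmono : MonotoneOn g (Icc u x) := by
        refine monotoneOn_of_deriv_nonneg (convex_Icc u x)
          (hgc.mono fun v hv => hu.trans_le hv.1) ?_ ?_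
        · intro v hv
          rw [interior_Icc] at hv
          exact (hgd v (hu.trans hv.1)).differentiableAt.differentiableWithinAt
        · intro v hv
          rw [interior_Icc] at hv
          have hv0 : 0 < v := hu.trans hv.1
          rw [(hgd v hv0).deriv]
          exact mul_nonneg (Real.rpow_nonneg hv0.le _) (sub_nonneg.2 (ha hv0 hx hv.2.le))
      exact hmono ⟨le_rfl, hux⟩ ⟨hux, le_rfl⟩ hux
    · have hanti : AntitoneOn g (Icc x u) := by
        refine antitoneOn_of_deriv_nonpos (convex_Icc x u)
          (hgc.mono fun v hv => hx.trans_le hv.1) ?_ ?_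
        · intro v hv
          rw [interior_Icc] at hv
          exact (hgd v (hx.trans hv.1)).differentiableAt.differentiableWithinAt
        · intro v hv
          rw [interior_Icc] at hv
          have hv0 : 0 < v := hx.trans hv.1
          rw [(hgd v hv0).deriv]
          exact mul_nonpos_of_nonneg_of_nonpos (Real.rpow_nonneg hv0.le _)
            (sub_nonpos.2 (ha hx hv0 hv.1.le))
      exact hanti ⟨le_rfl, hxu⟩ ⟨hxu, le_rfl⟩ hxu
  simp only [hg] at key
  linarith

/-! ### Gamma kernels and Fubini. -/

theorem integrableOn_gamma_kernel {a r : ℝ} (ha : 0 < a) (hr : 0 < r) :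
    IntegrableOn (fun t : ℝ => t ^ (a - 1) * Real.exp (-(r * t))) (Ioi 0) := by
  have := integrableOn_rpow_mul_exp_neg_mul_rpow (p := 1) (s := a - 1) (b := r)
    (by linarith) one_pos hr
  simpa using this

theorem integrableOn_gamma_kernel_mul {f : ℝ → ℝ} (hfc : ContinuousOn f (Ioi 0)) {C : ℝ}
    (hC : ∀ t : ℝ, 0 < t → |f t| ≤ C) {x y : ℝ} (hx : 0 < x) (hy : 0 < y) :
    IntegrableOn (fun t : ℝ => t ^ (y - 1) * Real.exp (-(y * t)) * f (x * t)) (Ioi 0) := by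
  refine Integrable.mul_bdd (c := C) (integrableOn_gamma_kernel hy hy) ?_ ?_
  · refine ContinuousOn.aestronglyMeasurable ?_ measurableSet_Ioi
    exact hfc.comp (by fun_prop) fun t ht => mul_pos hx ht
  · filter_upwards [ae_restrict_mem measurableSet_Ioi] with t ht
    exact hC _ (mul_pos hx ht)

theorem sigmaFinite_of_integrable_exp_neg {μ : Measure ℝ≥0}
    (h : Integrable (fun s : ℝ≥0 => Real.exp (-(s : ℝ))) μ) : SigmaFinite μ := by
  have : IsLocallyFiniteMeasure μ := by
    refine ⟨fun s => ⟨Iio (s + 1), Iio_mem_nhds (by simp), ?_⟩⟩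
    refine lt_of_le_of_lt (measure_mono ?_)
      (h.measure_norm_ge_lt_top (ε := Real.exp (-((s : ℝ) + 1))) (Real.exp_pos _))
    intro r hr
    have hr' : (r : ℝ) < s + 1 := by exact_mod_cast hr
    simp only [mem_ofPred_eq, Real.norm_eq_abs, Real.abs_exp, Real.exp_le_exp]
    linarith
  infer_instance

/-- Fubini for the Laplace transform against a gamma kernel. -/
theorem stieltjes_eq_gamma_integral {lam : ℝ} (hlam : 0 < lam) {f : ℝ → ℝ}
    (hfc : ContinuousOn f (Ioi 0)) {C : ℝ} (hC : ∀ t : ℝ, 0 < t → |f t| ≤ C)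
    {μ : Measure ℝ≥0} (hμ : IsBernsteinMeasure μ (fun t => t ^ (-lam) * f t))
    {x y : ℝ} (hx : 0 < x) (hy : 0 < y) :
    Integrable (fun s : ℝ≥0 => 1 / (y + x * (s : ℝ)) ^ (lam + y)) μ ∧
      Real.Gamma (lam + y) * ∫ s : ℝ≥0, 1 / (y + x * (s : ℝ)) ^ (lam + y) ∂μ =
        x ^ (-lam) * ∫ t in Ioi (0 : ℝ), t ^ (y - 1) * Real.exp (-(y * t)) * f (x * t) := by
  have hσ : SigmaFinite μ := by
    refine sigmaFinite_of_integrable_exp_neg ?_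
    simpa using (hμ 1 one_pos).1
  have hG : 0 < Real.Gamma (lam + y) := Real.Gamma_pos_of_pos (by positivity)
  set F : ℝ≥0 → ℝ → ℝ := fun s t => t ^ (lam + y - 1) * Real.exp (-((y + x * s) * t)) with hF
  have hsplit : ∀ (s : ℝ≥0) (t : ℝ), F s t =
      t ^ (lam + y - 1) * Real.exp (-(y * t)) * Real.exp (-(x * t * (s : ℝ))) := by
    intro s t
    rw [hF, mul_assoc, ← Real.exp_add]
    ring_nf
  have hinner : ∀ t : ℝ, 0 < t → ∫ s, F s t ∂μ =
      x ^ (-lam) * (t ^ (y - 1) * Real.exp (-(y * t)) * f (x * t)) := by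
    intro t ht
    simp_rw [hsplit]
    rw [integral_const_mul]
    have h : ∫ s : ℝ≥0, Real.exp (-(x * t * (s : ℝ))) ∂μ = (x * t) ^ (-lam) * f (x * t) :=
      (hμ (x * t) (mul_pos hx ht)).2
    rw [h, Real.mul_rpow hx.le ht.le]
    have h2 : t ^ (lam + y - 1) * t ^ (-lam) = t ^ (y - 1) := by
      rw [← Real.rpow_add ht]; ring_nf
    rw [← h2]; ring
  have houter : ∀ s : ℝ≥0, ∫ t in Ioi (0 : ℝ), F s t =
      Real.Gamma (lam + y) * (1 / (y + x * (s : ℝ)) ^ (lam + y)) := by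
    intro s
    have hpos : 0 < y + x * (s : ℝ) := by positivity
    have := Real.integral_rpow_mul_exp_neg_mul_Ioi (a := lam + y) (by positivity) hpos
    rw [hF, this, Real.div_rpow zero_le_one hpos.le, Real.one_rpow, mul_comm]
  have hint : Integrable (Function.uncurry F) (μ.prod (volume.restrict (Ioi 0))) := by
    have hm : AEStronglyMeasurable (Function.uncurry F) (μ.prod (volume.restrict (Ioi 0))) := by
      refine Measurable.aestronglyMeasurable ?_
      simp only [hF, Function.uncurry_def]
      fun_prop
    refine (integrable_prod_iff' hm).2 ⟨?_, ?_⟩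
    · filter_upwards [ae_restrict_mem measurableSet_Ioi] with t ht
      simp only [Function.uncurry_apply_pair, hsplit]
      exact (hμ (x * t) (mul_pos hx ht)).1.const_mul _
    -- Since `F ≥ 0`, the inner integral of the norm is the one in `hinner`, integrable in `t`
    -- because `f` is bounded.
    · refine ((integrableOn_gamma_kernel_mul hfc hC hx hy).const_mul (x ^ (-lam))).congr ?_
      filter_upwards [ae_restrict_mem measurableSet_Ioi] with t ht
      rw [← hinner t ht]
      refine integral_congr_ae (Filter.Eventually.of_forall fun s => ?_)
      have ht' : (0 : ℝ) < t := ht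
      have : 0 ≤ F s t := by simp only [hF]; positivity
      simp [Real.norm_of_nonneg this]
  constructor
  · have h1 := hint.integral_prod_left
    simp only [Function.uncurry_apply_pair, houter] at h1
    refine (h1.const_mul (Real.Gamma (lam + y))⁻¹).congr (Filter.Eventually.of_forall fun s => ?_)
    simp only
    field_simp
  · have h2 := integral_integral_swap hint
    simp only [houter] at h2
    rw [← integral_const_mul, h2, ← integral_const_mul]
    exact setIntegral_congr_fun measurableSet_Ioi fun t ht => hinner t ht

/-! ### Moments of the gamma kernel. -/

theorem integral_gamma_kernel_mul_rpow {p y : ℝ} (hp : 0 ≤ p) (hy : 0 < y) :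
    IntegrableOn (fun t : ℝ => t ^ (y - 1) * Real.exp (-(y * t)) * t ^ p) (Ioi 0) ∧
      ∫ t in Ioi (0 : ℝ), t ^ (y - 1) * Real.exp (-(y * t)) * t ^ p =
        Real.Gamma (y + p) / y ^ (y + p) := by
  have hEq : EqOn (fun t : ℝ => t ^ (y + p - 1) * Real.exp (-(y * t)))
      (fun t : ℝ => t ^ (y - 1) * Real.exp (-(y * t)) * t ^ p) (Ioi 0) := by
    intro t ht
    have : t ^ (y + p - 1) = t ^ (y - 1) * t ^ p := by
      rw [← Real.rpow_add ht]; ring_nf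
    simp only [this]; ring
  refine ⟨(integrableOn_gamma_kernel (by positivity) hy).congr_fun hEq measurableSet_Ioi, ?_⟩
  rw [← setIntegral_congr_fun measurableSet_Ioi hEq,
    Real.integral_rpow_mul_exp_neg_mul_Ioi (by positivity) hy,
    Real.div_rpow zero_le_one hy.le, Real.one_rpow]
  ring

theorem integral_gamma_kernel {y : ℝ} (hy : 0 < y) :
    ∫ t in Ioi (0 : ℝ), t ^ (y - 1) * Real.exp (-(y * t)) = Real.Gamma y / y ^ y := by
  simpa using (integral_gamma_kernel_mul_rpow le_rfl hy).2

theorem gamma_div_rpow_add_one {y : ℝ} (hy : 0 < y) :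
    Real.Gamma (y + 1) / y ^ (y + 1) = Real.Gamma y / y ^ y := by
  rw [Real.Gamma_add_one hy.ne', Real.rpow_add_one hy.ne', mul_comm (y ^ y),
    mul_div_mul_left _ _ hy.ne']

/-- Integrate Bernoulli's `1 + p * (t - 1) ≤ t ^ p` against the kernel; the linear term vanishes
because the mean is 1. -/
theorem gamma_div_rpow_le {p y : ℝ} (hp : 1 ≤ p) (hy : 0 < y) :
    Real.Gamma y / y ^ y ≤ Real.Gamma (y + p) / y ^ (y + p) := by
  have h0 := integrableOn_gamma_kernel hy hy
  obtain ⟨i1, e1⟩ := integral_gamma_kernel_mul_rpow zero_le_one hy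
  obtain ⟨ip, ep⟩ := integral_gamma_kernel_mul_rpow (zero_le_one.trans hp) hy
  have isub : IntegrableOn (fun t : ℝ => p * (t ^ (y - 1) * Real.exp (-(y * t)) * t ^ (1 : ℝ) -
      t ^ (y - 1) * Real.exp (-(y * t)))) (Ioi 0) := (i1.sub h0).const_mul p
  have hle : ∫ t in Ioi (0 : ℝ), (t ^ (y - 1) * Real.exp (-(y * t)) +
      p * (t ^ (y - 1) * Real.exp (-(y * t)) * t ^ (1 : ℝ) - t ^ (y - 1) * Real.exp (-(y * t)))) ≤
      ∫ t in Ioi (0 : ℝ), t ^ (y - 1) * Real.exp (-(y * t)) * t ^ p := by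
    refine setIntegral_mono_on (h0.add isub) ip measurableSet_Ioi ?_
    intro t ht
    have ht' : (0 : ℝ) < t := ht
    have hb := one_add_mul_self_le_rpow_one_add (s := t - 1) (by linarith) hp
    rw [add_sub_cancel] at hb
    have hk : 0 ≤ t ^ (y - 1) * Real.exp (-(y * t)) := by positivity
    rw [Real.rpow_one]
    calc _ = t ^ (y - 1) * Real.exp (-(y * t)) * (1 + p * (t - 1)) := by ring
      _ ≤ _ := mul_le_mul_of_nonneg_left hb hk
  rw [integral_add h0 isub, integral_const_mul, integral_sub i1 h0, e1, ep,
    integral_gamma_kernel hy, gamma_div_rpow_add_one hy] at hle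
  simpa using hle

/-! ### Strict Jensen inequality. -/

theorem exists_lt_tangent_rpow {f : ℝ → ℝ} (hbdd : ∃ C : ℝ, ∀ t : ℝ, 0 < t → |f t| ≤ C)
    (hnonconst : ¬ ∃ c : ℝ, ∀ t : ℝ, 0 < t → f t = c) {p a c : ℝ} (hp : 0 < p)
    (hle : ∀ u : ℝ, 0 < u → f u ≤ a + c * u ^ p) : ∃ u : ℝ, 0 < u ∧ f u < a + c * u ^ p := by
  by_contra! hcon
  have heq : ∀ u : ℝ, 0 < u → f u = a + c * u ^ p := fun u hu => le_antisymm (hle u hu) (hcon u hu)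
  obtain ⟨C, hC⟩ := hbdd
  rcases eq_or_ne c 0 with rfl | hc
  · exact hnonconst ⟨a, fun t ht => by simpa using heq t ht⟩
  have hc' : 0 < |c| := abs_pos.2 hc
  have hC0 : 0 ≤ C := (abs_nonneg _).trans (hC 1 one_pos)
  -- Makes `|c * v|` exceed `C + |a|`, against the bound on `f` at `v ^ p⁻¹`.
  set v := (C + |a| + 1) / |c| with hv
  have hv0 : 0 < v := by positivity
  have h1 := hC (v ^ p⁻¹) (by positivity)
  rw [heq _ (by positivity), Real.rpow_inv_rpow hv0.le hp.ne'] at h1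
  have h2 : |c * v| = C + |a| + 1 := by
    rw [abs_mul, abs_of_pos hv0, hv]; field_simp
  have h3 : |c * v| ≤ |a + c * v| + |a| := by
    calc |c * v| = |(a + c * v) - a| := by ring_nf
      _ ≤ _ := abs_sub _ _
  linarith

theorem integral_gamma_kernel_mul_lt {f : ℝ → ℝ}
    (hd : ∀ u : ℝ, 0 < u → DifferentiableAt ℝ f u)
    (hbdd : ∃ C : ℝ, ∀ t : ℝ, 0 < t → |f t| ≤ C)
    (hnonconst : ¬ ∃ c : ℝ, ∀ t : ℝ, 0 < t → f t = c) {p c x y : ℝ} (hp : 0 < p)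
    (hx : 0 < x) (hy : 0 < y)
    (hle : ∀ u : ℝ, 0 < u → f u ≤ f x + c * (u ^ p - x ^ p)) :
    ∫ t in Ioi (0 : ℝ), t ^ (y - 1) * Real.exp (-(y * t)) * f (x * t) <
      f x * (Real.Gamma y / y ^ y) +
        c * x ^ p * (Real.Gamma (y + p) / y ^ (y + p) - Real.Gamma y / y ^ y) := by
  have hfc : ContinuousOn f (Ioi 0) := fun v hv => (hd v hv).continuousAt.continuousWithinAt
  obtain ⟨C, hC⟩ := hbdd
  have i0 := integrableOn_gamma_kernel hy hy
  obtain ⟨ip, ep⟩ := integral_gamma_kernel_mul_rpow hp.le hy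
  have hi := integrableOn_gamma_kernel_mul hfc hC hx hy
  have isub : IntegrableOn (fun t : ℝ => c * x ^ p * (t ^ (y - 1) * Real.exp (-(y * t)) * t ^ p -
      t ^ (y - 1) * Real.exp (-(y * t)))) (Ioi 0) := (ip.sub i0).const_mul (c * x ^ p)
  have ib : IntegrableOn (fun t : ℝ => f x * (t ^ (y - 1) * Real.exp (-(y * t))) +
      c * x ^ p * (t ^ (y - 1) * Real.exp (-(y * t)) * t ^ p -
        t ^ (y - 1) * Real.exp (-(y * t)))) (Ioi 0) := (i0.const_mul (f x)).add isub
  have eb : ∫ t in Ioi (0 : ℝ), (f x * (t ^ (y - 1) * Real.exp (-(y * t))) +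
      c * x ^ p * (t ^ (y - 1) * Real.exp (-(y * t)) * t ^ p -
        t ^ (y - 1) * Real.exp (-(y * t)))) = f x * (Real.Gamma y / y ^ y) +
        c * x ^ p * (Real.Gamma (y + p) / y ^ (y + p) - Real.Gamma y / y ^ y) := by
    rw [integral_add (i0.const_mul (f x)) isub, integral_const_mul,
      integral_const_mul, integral_sub ip i0, ep, integral_gamma_kernel hy]
  rw [← eb, ← sub_pos, ← integral_sub ib hi]
  set φ : ℝ → ℝ := fun t => f x + c * ((x * t) ^ p - x ^ p) - f (x * t) with hφ
  have hform : EqOn (fun t : ℝ => t ^ (y - 1) * Real.exp (-(y * t)) * φ t)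
      (fun t => (f x * (t ^ (y - 1) * Real.exp (-(y * t))) +
      c * x ^ p * (t ^ (y - 1) * Real.exp (-(y * t)) * t ^ p -
        t ^ (y - 1) * Real.exp (-(y * t)))) -
          t ^ (y - 1) * Real.exp (-(y * t)) * f (x * t)) (Ioi 0) := by
    intro t ht
    simp only [hφ, Real.mul_rpow hx.le (le_of_lt ht)]
    ring
  have hii : IntegrableOn (fun t : ℝ => t ^ (y - 1) * Real.exp (-(y * t)) * φ t) (Ioi 0) :=
    (ib.sub hi).congr ((ae_restrict_mem measurableSet_Ioi).mono fun t ht => (hform ht).symm)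
  refine lt_of_lt_of_eq ?_ (setIntegral_congr_fun measurableSet_Ioi hform)
  have hφ0 : ∀ t : ℝ, 0 < t → 0 ≤ φ t := fun t ht => sub_nonneg.2 (hle _ (mul_pos hx ht))
  have hφc : ContinuousOn φ (Ioi 0) := by
    have h1 : ContinuousOn (fun t => f (x * t)) (Ioi 0) :=
      hfc.comp (by fun_prop) fun t ht => mul_pos hx ht
    have h2 : Continuous fun t : ℝ => (x * t) ^ p :=
      (continuous_const_mul x).rpow_const fun _ => Or.inr hp.le
    exact (continuousOn_const.add (continuousOn_const.mul
      (h2.continuousOn.sub continuousOn_const))).sub h1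
  rw [setIntegral_pos_iff_support_of_nonneg_ae ?_ hii]
  · obtain ⟨u, hu, hlt⟩ := exists_lt_tangent_rpow (p := p) (a := f x - c * x ^ p) (c := c)
      ⟨C, hC⟩ hnonconst hp (fun u hu => by linarith [hle u hu])
    -- One point of strict inequality spreads by continuity to an open set, which has positive
    -- measure.
    have ho : IsOpen (Ioi 0 ∩ φ ⁻¹' Ioi 0) := hφc.isOpen_inter_preimage isOpen_Ioi isOpen_Ioi
    have hne : (Ioi 0 ∩ φ ⁻¹' Ioi 0).Nonempty := by
      refine ⟨u / x, div_pos hu hx, ?_⟩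
      simp only [hφ, mem_preimage, mem_Ioi, mul_div_cancel₀ u hx.ne']
      linarith
    refine (ho.measure_pos volume hne).trans_le (measure_mono ?_)
    rintro t ⟨ht, hpt⟩
    have ht' : (0 : ℝ) < t := ht
    have hpt' : 0 < φ t := hpt
    exact ⟨(by positivity : t ^ (y - 1) * Real.exp (-(y * t)) * φ t ≠ 0), ht⟩
  · filter_upwards [ae_restrict_mem measurableSet_Ioi] with t ht
    have ht' : (0 : ℝ) < t := ht
    have := hφ0 t ht
    simp only [Pi.zero_apply]
    positivity

theorem IsGenBernstein.differentiableAt {lam : ℝ} {f : ℝ → ℝ} (hf : IsGenBernstein lam f) {u : ℝ}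
    (hu : 0 < u) : DifferentiableAt ℝ f u :=
  (hf.1.differentiableOn (by simp)).differentiableAt (Ioi_mem_nhds hu)

/-- A product of two nonnegative antitone factors, the second being `v ^ (lam - 1)`. -/
theorem IsGenBernstein.antitoneOn_deriv {lam : ℝ} {f : ℝ → ℝ} (hf : IsGenBernstein lam f)
    (hlam : lam ≤ 1) : AntitoneOn (deriv f) (Ioi 0) := by
  have hsplit : ∀ v : ℝ, 0 < v → deriv f v = deriv f v * v ^ (1 - lam) * v ^ (lam - 1) := by
    intro v hv
    rw [mul_assoc, ← Real.rpow_add hv]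
    simp
  intro u hu v hv huv
  rw [hsplit u hu, hsplit v hv]
  exact mul_le_mul (hf.2.2.antitoneOn hu hv huv)
    (Real.rpow_le_rpow_of_nonpos hu huv (by linarith)) (Real.rpow_nonneg (le_of_lt hv) _)
    (hf.2.2.nonneg hu)

/-- Let `u → 0+` in `0 ≤ f u ≤` tangent. -/
theorem mul_rpow_le_of_le_tangent {f : ℝ → ℝ} (hf0 : ∀ u : ℝ, 0 < u → 0 ≤ f u) {p c x : ℝ}
    (hp : 0 < p) (hle : ∀ u : ℝ, 0 < u → f u ≤ f x + c * (u ^ p - x ^ p)) :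
    c * x ^ p ≤ f x := by
  have hc : Continuous fun u : ℝ => f x + c * (u ^ p - x ^ p) := by
    have := Real.continuous_rpow_const hp.le
    fun_prop
  have ht : Filter.Tendsto (fun u : ℝ => f x + c * (u ^ p - x ^ p)) (nhdsWithin 0 (Ioi 0))
      (nhds (f x + c * ((0 : ℝ) ^ p - x ^ p))) := (hc.tendsto 0).mono_left nhdsWithin_le_nhds
  have := ge_of_tendsto ht (by
    filter_upwards [self_mem_nhdsWithin] with u hu
    exact (hf0 u hu).trans (hle u hu))
  rw [Real.zero_rpow hp.ne'] at this
  linarith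

theorem corollary2p5 (lam : ℝ) (hlam : 0 < lam) (f : ℝ → ℝ)
    (hf : IsGenBernstein lam f)
    (hbdd : ∃ C : ℝ, ∀ t : ℝ, 0 < t → |f t| ≤ C)
    (hnonconst : ¬ ∃ c : ℝ, ∀ t : ℝ, 0 < t → f t = c)
    (μ : Measure ℝ≥0)
    (hμ : IsBernsteinMeasure μ (fun t => t ^ (-lam) * f t)) :
    (lam ≤ 1 → ∀ x y : ℝ, 0 < x → 0 < y →
      Integrable (fun s : ℝ≥0 => 1 / (y + x * (s : ℝ)) ^ (lam + y)) μ ∧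
      y ^ y * (Real.Gamma (lam + y) / Real.Gamma y) *
          ∫ s : ℝ≥0, 1 / (y + x * (s : ℝ)) ^ (lam + y) ∂μ
        < laplaceTransform μ x) ∧
    (1 < lam → ∀ x y : ℝ, 0 < x → 0 < y →
      Integrable (fun s : ℝ≥0 => 1 / (y + x * (s : ℝ)) ^ (lam + y)) μ ∧
      y ^ (lam + y) * ∫ s : ℝ≥0, 1 / (y + x * (s : ℝ)) ^ (lam + y) ∂μ
        < laplaceTransform μ x) := by
  have hd : ∀ u : ℝ, 0 < u → DifferentiableAt ℝ f u := fun u hu => hf.differentiableAt hu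
  have hfc : ContinuousOn f (Ioi 0) := hf.1.continuousOn
  obtain ⟨C, hC⟩ := hbdd
  refine ⟨fun h1 x y hx hy => ?_, fun h1 x y hx hy => ?_⟩
  · obtain ⟨hint, heq⟩ := stieltjes_eq_gamma_integral hlam hfc hC hμ hx hy
    refine ⟨hint, ?_⟩
    have hle : ∀ u : ℝ, 0 < u → f u ≤ f x + deriv f x * x ^ (1 - 1 : ℝ) / 1 *
        (u ^ (1 : ℝ) - x ^ (1 : ℝ)) := fun u hu =>
      le_tangent_rpow one_pos hd (by simpa using hf.antitoneOn_deriv h1) hx hu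
    have hlt := integral_gamma_kernel_mul_lt hd ⟨C, hC⟩ hnonconst one_pos hx hy hle
    -- Mean 1 kills the slope term.
    rw [gamma_div_rpow_add_one hy, sub_self (Real.Gamma y / y ^ y), mul_zero, add_zero] at hlt
    have hG : 0 < Real.Gamma y := Real.Gamma_pos_of_pos hy
    have hyy : 0 < y ^ y := Real.rpow_pos_of_pos hy y
    rw [(hμ x hx).2, mul_assoc, div_mul_eq_mul_div, heq]
    calc _ = y ^ y / Real.Gamma y * x ^ (-lam) *
          ∫ t in Ioi (0 : ℝ), t ^ (y - 1) * Real.exp (-(y * t)) * f (x * t) := by ring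
      _ < y ^ y / Real.Gamma y * x ^ (-lam) * (f x * (Real.Gamma y / y ^ y)) :=
        mul_lt_mul_of_pos_left hlt (by positivity)
      _ = x ^ (-lam) * f x := by field_simp
  · obtain ⟨hint, heq⟩ := stieltjes_eq_gamma_integral hlam hfc hC hμ hx hy
    refine ⟨hint, ?_⟩
    have hle : ∀ u : ℝ, 0 < u → f u ≤ f x + deriv f x * x ^ (1 - lam) / lam *
        (u ^ lam - x ^ lam) := fun u hu =>
      le_tangent_rpow hlam hd hf.2.2.antitoneOn hx hu
    have hlt := integral_gamma_kernel_mul_lt hd ⟨C, hC⟩ hnonconst hlam hx hy hle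
    have hcx := mul_rpow_le_of_le_tangent hf.2.1 hlam hle
    have hG : 0 < Real.Gamma (lam + y) := Real.Gamma_pos_of_pos (by positivity)
    have hyy : 0 < y ^ (lam + y) := Real.rpow_pos_of_pos hy _
    have hgam := gamma_div_rpow_le h1.le hy
    -- The slope coefficient may be raised to `f x` because the moment difference is nonnegative;
    -- the zeroth moments then cancel.
    have hlt' := hlt.trans_le (add_le_add_right
      (mul_le_mul_of_nonneg_right hcx (sub_nonneg.2 hgam)) _)
    rw [← mul_add, add_sub_cancel, add_comm y lam] at hlt'
    rw [(hμ x hx).2]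
    calc _ = y ^ (lam + y) / Real.Gamma (lam + y) * (Real.Gamma (lam + y) *
          ∫ s : ℝ≥0, 1 / (y + x * (s : ℝ)) ^ (lam + y) ∂μ) := by field_simp
      _ = y ^ (lam + y) / Real.Gamma (lam + y) * x ^ (-lam) *
          ∫ t in Ioi (0 : ℝ), t ^ (y - 1) * Real.exp (-(y * t)) * f (x * t) := by
        rw [heq]; ring
      _ < y ^ (lam + y) / Real.Gamma (lam + y) * x ^ (-lam) *
          (f x * (Real.Gamma (lam + y) / y ^ (lam + y))) :=
        mul_lt_mul_of_pos_left hlt' (by positivity)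
      _ = x ^ (-lam) * f x := by field_simp
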